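/- Let $\mathbb{K}$ be a field of characteristic zero and let $\mathcal{S} = \bigsqcup_{n \geq 1} \mathcal{S}(n)$ be a positive signature, that is, a set of symbols each having an arity $n \geq 1$. An $\mathcal{S}$-term is either the leaf $\perp$ or a pair $(\mathsf{g}, (\mathfrak{t}_1, \dots, \mathfrak{t}_n))$ with $\mathsf{g} \in \mathcal{S}(n)$ and $\mathcal{S}$-terms $\mathfrak{t}_1, \dots, \mathfrak{t}_n$; it is seen as a planar rooted tree whose internal nodes are decorated by $\mathcal{S}$. A reduced $\mathcal{S}$-forest is a finite (possibly empty) word of $\mathcal{S}$-terms, none of which is $\perp$; let $R$ be the set of reduced $\mathcal{S}$-forests. Let $\mathbf{N}$ be the $\mathbb{K}$-vector space with basis $\{\mathsf{E}_{\mathfrak{f}} : \mathfrak{f} \in R\}$, endowed with the bilinear product that extends the concatenation of forests (the algebra underlying the natural Hopf algebra of the free operad on $\mathcal{S}$). For $\mathfrak{f}, \mathfrak{f}' \in R$, write $\mathfrak{f} \rightharpoonup \mathfrak{f}'$ if $\mathfrak{f}'$ is obtained from $\mathfrak{f}$ by selecting an internal node having an immediate left brother (the brother may be a leaf, and the roots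 of the successive terms of $\mathfrak{f}$ are considered as brothers), detaching the subterm rooted at this node, and grafting it onto the rightmost leaf of its former immediate left brother. When the detached node is not the root of a term, a leaf remains at its place; when it is the root of a term, the forest loses one term. The reflexive and transitive closure $\preccurlyeq$ of $\rightharpoonup$ is a partial order on $R$, the easterly wind order, in which every element has finitely many elements above it and finitely many below it. Let $\mu$ be its Möbius function and set, for $\mathfrak{f} \in R$, $$\mathsf{F}_{\mathfrak{f}} := \sum_{\mathfrak{f}' \in R,\ \mathfrak{f} \preccurlyeq \mathfrak{f}'} \mu(\mathfrak{f}, \mathfrak{f}')\, \mathsf{E}_{\mathfrak{f}'}, \qquad \mathsf{H}_{\mathfrak{f}} := \sum_{\mathfrak{f}' \in R,\ \mathfrak{f}' \preccurlyeq \mathfrak{f}} \mathsf{F}_{\mathfrak{f}'}.$$ A leaf of a term $\mathfrak{t}$ is extremal if, when a new node is grafted onto it, this node is the last internal node of the resulting term in the left to right preorder traversal. For $\mathfrak{f}', \mathfrak{f}'' \in R$, let $\mathfrak{f}' \,/\, \mathfrak{f}''$ ("over") be the concatenation of $\mathfrak{f}'$ and $\mathfrak{f}''$, and let $\mathfrak{f}'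 \,\backslash\, \mathfrak{f}''$ ("under") be obtained from this concatenation as follows: for $k = 1, 2, \dots$, the $k$-th term of $\mathfrak{f}''$ is grafted onto the $k$-th leftmost extremal leaf of the last term $\mathfrak{t}$ of $\mathfrak{f}'$, where the extremal leaves are those of the original term $\mathfrak{t}$, until no term of $\mathfrak{f}''$ or no extremal leaf of $\mathfrak{t}$ remains; the terms of $\mathfrak{f}''$ that have not been grafted stay, in order, at the end of the forest. If $\mathfrak{f}'$ is empty, then $\mathfrak{f}' \,\backslash\, \mathfrak{f}'' := \mathfrak{f}''$. Then, for all $\mathfrak{f}', \mathfrak{f}'' \in R$, $$\mathsf{E}_{\mathfrak{f}'} \cdot \mathsf{E}_{\mathfrak{f}''} = \mathsf{E}_{\mathfrak{f}' / \mathfrak{f}''}, \qquad \mathsf{F}_{\mathfrak{f}'} \cdot \mathsf{F}_{\mathfrak{f}''} = \sum_{\mathfrak{f} \in R,\ \mathfrak{f}' / \mathfrak{f}'' \preccurlyeq \mathfrak{f} \preccurlyeq \mathfrak{f}' \backslash \mathfrak{f}''} \mathsf{F}_{\mathfrak{f}}, \qquad \mathsf{H}_{\mathfrak{f}'} \cdot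 \mathsf{H}_{\mathfrak{f}''} = \mathsf{H}_{\mathfrak{f}' \backslash \mathfrak{f}''}.$$ -/

import Mathlib

universe u v

/-- Terms on a signature `S`, where `S n` is the set of symbols of arity `n`: planar rooted trees
whose internal nodes of arity `n` are decorated by elements of `S n`. -/
inductive Term (S : ℕ → Type u) : Type u
  | leaf : Term S
  | node {n : ℕ} (g : S n) (ts : Fin n → Term S) : Term S

namespace Term

variable {S : ℕ → Type u}

/-- The number of leaves. -/
def arity : Term S → ℕ
  | leaf => 1
  | node _ ts => ∑ i, (ts i).arity

/-- The decorations of the internal nodes, in the left to right preorder traversal. -/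
def preorder : Term S → List (Σ n, S n)
  | leaf => []
  | @node _ n g ts => ⟨n, g⟩ :: (List.ofFn fun i => (ts i).preorder).flatten

/-- Full composition `t[σ 0, σ 1, …]` of the free operad: the root of `σ i` is grafted onto the
`i`-th leaf of `t`, where leaves are numbered from `0`, from left to right.
Only the values `σ i` with `i < t.arity` matter. -/
def comp : Term S → (ℕ → Term S) → Term S
  | leaf, σ => σ 0
  | node g ts, σ =>
    node g fun k => (ts k).comp fun i => σ ((∑ j : Fin k, (ts (j.castLE k.isLt.le)).arity) + i)

/-- Partial composition `t ∘ᵢ s`: grafts `s` onto the `i`-th leaf of `t`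
(leaves are numbered from `0`). -/
def partialComp (t : Term S) (i : ℕ) (s : Term S) : Term S :=
  t.comp fun j => if j = i then s else leaf

/-- Relabelling of the internal nodes. -/
def map {S' : ℕ → Type v} (φ : ∀ n, S n → S' n) : Term S → Term S'
  | leaf => leaf
  | @node _ n g ts => node (φ n g) fun i => (ts i).map φ

/-- Grafts `s` onto the rightmost leaf of `t` (for a positive signature, this leaf is reached by
going from the root to the last child repeatedly). -/
def graftRight : Term S → Term S → Term S
  | leaf, s => s
  | @node _ n g ts, s => node g fun i => if (i : ℕ) + 1 = n then (ts i).graftRight s else ts i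

/-- `t.Step t'`: an internal node of `t`, different from the root, is selected, the subterm
rooted at it is detached (so that a leaf remains at its place) and grafted onto the rightmost leaf
of its former immediate left brother. This brother may be a leaf. -/
inductive Step : Term S → Term S → Prop
  | slide {n : ℕ} (g : S n) (ts : Fin n → Term S) (i j : Fin n) (hij : (i : ℕ) + 1 = j)
      (hj : ts j ≠ leaf) :
      Step (node g ts)
        (node g (Function.update (Function.update ts i ((ts i).graftRight (ts j))) j leaf))
  | child {n : ℕ} (g : S n) (ts : Fin n → Term S) (i : Fin n) (t' : Term S) (h : Step (ts i) t') :
      Step (node g ts) (node g (Function.update ts i t'))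

end Term

/-- The signature `S ⊔ {𝔡}` where `𝔡 = WithConst.const` is a new constant of arity `0`. -/
inductive WithConst (S : ℕ → Type u) : ℕ → Type u
  | base {n : ℕ} (g : S n) : WithConst S n
  | const : WithConst S 0

namespace Term

variable {S : ℕ → Type u}

/-- The `i`-th leaf of `t` (numbered from `0`) is extremal if the node decorated by `𝔡` in
`t ∘ᵢ 𝔡` is the last internal node in preorder. -/
def IsExtremal (t : Term S) (i : ℕ) : Prop :=
  i < t.arity ∧
    ((t.map fun _ g => WithConst.base g).partialComp i
      (node WithConst.const Fin.elim0)).preorder.getLast? = some ⟨0, WithConst.const⟩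

end Term

/-- The covering relation on forests: either the selected internal node is the root of a term `t`
of the forest, which is grafted onto the rightmost leaf of the term on its left, or
it lies inside a term of the forest. -/
inductive ForestStep {S : ℕ → Type u} : List (Term S) → List (Term S) → Prop
  | root (p q : List (Term S)) (s t : Term S) :
      ForestStep (p ++ s :: t :: q) (p ++ s.graftRight t :: q)
  | inner (p q : List (Term S)) (t t' : Term S) (h : t.Step t') :
      ForestStep (p ++ t :: q) (p ++ t' :: q)

/-- Reduced forests: words of terms, none of which is the leaf. -/
def RForest (S : ℕ → Type u) : Type u := {f : List (Term S) // ∀ t ∈ f, t ≠ Term.leaf}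

namespace Term

variable {S : ℕ → Type u}

/-- The number of internal nodes. -/
def degree : Term S → ℕ
  | leaf => 0
  | node _ ts => 1 + ∑ i, (ts i).degree

/-- The multiset of decorations; auxiliary, for finiteness. -/
def content : Term S → Multiset (Σ n, S n)
  | leaf => 0
  | @node _ n g ts => {⟨n, g⟩} + ∑ i, (ts i).content

/-- Auxiliary statistic, strictly increasing along the easterly wind order. -/
def stat : Term S → ℕ
  | leaf => 0
  | @node _ n _ ts => ∑ i : Fin n, ((ts i).stat + (n - i) * (ts i).degree)

theorem degree_pos {t : Term S} (h : t ≠ leaf) : 0 < t.degree := by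
  cases t with
  | leaf => exact absurd rfl h
  | node g ts => simp [degree]

theorem card_content (t : Term S) : t.content.card = t.degree := by
  induction t with
  | leaf => rfl
  | node g ts ih => simp [content, degree, ih, add_comm]

theorem comp_ne_leaf {t : Term S} (h : t ≠ leaf) (σ : ℕ → Term S) : t.comp σ ≠ leaf := by
  cases t with
  | leaf => exact absurd rfl h
  | node g ts => simp [comp]

theorem sum_ite_last {M : Type*} [AddCommMonoid M] {n : ℕ} (a b : Fin (n + 1) → M) :
    ∑ i : Fin (n + 1), (if (i : ℕ) + 1 = n + 1 then b i else a i)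
      = (∑ i : Fin n, a i.castSucc) + b (Fin.last n) := by
  rw [Fin.sum_univ_castSucc]
  congr 1
  · refine Finset.sum_congr rfl fun i _ => ?_
    have := i.isLt
    rw [if_neg (by simp; omega)]
  · simp

theorem content_graftRight [IsEmpty (S 0)] (t s : Term S) :
    (t.graftRight s).content = t.content + s.content := by
  induction t with
  | leaf => simp [graftRight, content]
  | @node n g ts ih =>
    cases n with
    | zero => exact isEmptyElim g
    | succ n =>
      simp only [graftRight, content, apply_ite content, sum_ite_last, ih]
      rw [Fin.sum_univ_castSucc]
      simp only [add_assoc]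

theorem degree_graftRight [IsEmpty (S 0)] (t s : Term S) :
    (t.graftRight s).degree = t.degree + s.degree := by
  simp only [← card_content, content_graftRight, Multiset.card_add]

theorem stat_graftRight [IsEmpty (S 0)] (t s : Term S) :
    t.stat + s.stat ≤ (t.graftRight s).stat ∧
      (t ≠ leaf → t.stat + s.stat + s.degree ≤ (t.graftRight s).stat) := by
  induction t with
  | leaf => simp [graftRight, stat]
  | @node n g ts ih =>
    cases n with
    | zero => exact isEmptyElim g
    | succ n =>
      have key : (node g ts).stat + s.stat + s.degree ≤ ((node g ts).graftRight s).stat := by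
        have h1 : ((node g ts).graftRight s).stat
            = ∑ i : Fin (n + 1), (if (i : ℕ) + 1 = n + 1 then
                (((ts i).graftRight s).stat + (n + 1 - i) * ((ts i).graftRight s).degree)
                else ((ts i).stat + (n + 1 - i) * (ts i).degree)) := by
          simp only [graftRight, stat]
          refine Finset.sum_congr rfl fun i _ => ?_
          split_ifs <;> rfl
        rw [h1, sum_ite_last]
        simp only [stat]
        rw [Fin.sum_univ_castSucc]
        have h2 := (ih (Fin.last n)).1
        simp only [degree_graftRight, Fin.val_last, Nat.add_sub_cancel_left, one_mul,
          Fin.val_castSucc]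
        omega
      exact ⟨by omega, fun _ => key⟩

theorem sum_pair {n : ℕ} {M : Type*} [AddCommMonoid M] (a : Fin n → M) {i j : Fin n}
    (h : i ≠ j) : ∑ k, a k = a i + a j + ∑ k ∈ (Finset.univ.erase i).erase j, a k := by
  rw [← Finset.add_sum_erase _ a (Finset.mem_univ i),
    ← Finset.add_sum_erase _ a (Finset.mem_erase.2 ⟨h.symm, Finset.mem_univ j⟩), add_assoc]

theorem Step.content_eq [IsEmpty (S 0)] {t t' : Term S} (h : t.Step t') :
    t'.content = t.content := by
  induction h with
  | slide g ts i j hij hj =>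
    have hne : i ≠ j := by rintro rfl; omega
    simp only [content]
    rw [sum_pair _ hne, sum_pair (fun k => (ts k).content) hne]
    congr 1
    congr 1
    · simp [Function.update_of_ne hne, content_graftRight, content]
    · refine Finset.sum_congr rfl fun k hk => ?_
      simp only [Finset.mem_erase] at hk
      rw [Function.update_of_ne hk.1, Function.update_of_ne hk.2.1]
  | child g ts i t' _ ih =>
    simp only [content]
    congr 1
    refine Finset.sum_congr rfl fun k _ => ?_
    by_cases hk : k = i
    · subst hk; simp [ih]
    · rw [Function.update_of_ne hk]

theorem Step.degree_eq [IsEmpty (S 0)] {t t' : Term S} (h : t.Step t') :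
    t'.degree = t.degree := by
  simp only [← card_content, h.content_eq]

theorem Step.stat_lt [IsEmpty (S 0)] {t t' : Term S} (h : t.Step t') : t.stat < t'.stat := by
  induction h with
  | @slide n g ts i j hij hj =>
    have hne : i ≠ j := by rintro rfl; omega
    simp only [stat]
    rw [sum_pair (fun k : Fin n => (ts k).stat + (n - k) * (ts k).degree) hne, sum_pair _ hne]
    refine add_lt_add_of_lt_of_le ?_ (le_of_eq (Finset.sum_congr rfl fun k hk => ?_))
    · have h1 := (stat_graftRight (ts i) (ts j)).1
      have h2 := degree_pos hj
      have h3 : n - (i : ℕ) = (n - (j : ℕ)) + 1 := by have := j.isLt; omega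
      simp only [Function.update_of_ne hne, Function.update_self, stat, degree,
        degree_graftRight, h3]
      nlinarith
    · simp only [Finset.mem_erase] at hk
      rw [Function.update_of_ne hk.1, Function.update_of_ne hk.2.1]
  | @child n g ts i t' h ih =>
    simp only [stat]
    refine Finset.sum_lt_sum (fun k _ => ?_) ⟨i, Finset.mem_univ i, ?_⟩
    · by_cases hk : k = i
      · subst hk; simp only [Function.update_self, h.degree_eq]; omega
      · rw [Function.update_of_ne hk]
    · simp only [Function.update_self, h.degree_eq]; omega

theorem finite_content_le (W : Multiset (Σ n, S n)) (m : ℕ) :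
    {t : Term S | t.degree ≤ m ∧ t.content ≤ W}.Finite := by
  induction m with
  | zero =>
    refine (Set.finite_singleton (leaf : Term S)).subset ?_
    rintro t ⟨ht, -⟩
    by_contra hne
    have := degree_pos hne
    omega
  | succ m ih =>
    have hW : {p : Σ n, S n | p ∈ W}.Finite := by
      classical
      exact W.toFinset.finite_toSet.subset fun p hp => by simpa using hp
    refine ((Set.finite_singleton (leaf : Term S)).union (hW.biUnion fun p _ =>
      (Set.Finite.pi' (ι := Fin p.1) (fun _ => ih)).image (node p.2))).subset ?_
    rintro t ⟨ht, hc⟩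
    cases t with
    | leaf => exact Or.inl rfl
    | @node n g ts =>
      refine Or.inr (Set.mem_biUnion (x := (⟨n, g⟩ : Σ n, S n)) ?_ ⟨ts, fun i => ⟨?_, ?_⟩, rfl⟩)
      · exact Multiset.mem_of_le hc (by simp [content])
      · have := Finset.single_le_sum (f := fun i => (ts i).degree)
          (fun _ _ => Nat.zero_le _) (Finset.mem_univ i)
        simp only [degree] at ht
        omega
      · refine le_trans ?_ hc
        simp only [content]
        rw [← Finset.add_sum_erase _ _ (Finset.mem_univ i)]
        exact (Multiset.le_add_right _ _).trans (Multiset.le_add_left _ _)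

end Term

namespace RForest

variable {S : ℕ → Type u}

/-- The over operation: concatenation. -/
def opOver (f f' : RForest S) : RForest S :=
  ⟨f.1 ++ f'.1, fun t ht => (List.mem_append.1 ht).elim (f.2 t) (f'.2 t)⟩

/-- Reduced forests form a monoid under concatenation. -/
instance : Monoid (RForest S) where
  mul := opOver
  one := ⟨[], by simp⟩
  mul_assoc f g h := Subtype.ext (List.append_assoc f.1 g.1 h.1)
  one_mul f := Subtype.ext (List.nil_append f.1)
  mul_one f := Subtype.ext (List.append_nil f.1)

open Classical in
/-- Grafts the terms of `s` onto the extremal leaves of `t`: the `k`-th term goes onto the `k`-th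
leftmost extremal leaf of `t` (here `Nat.count t.IsExtremal i` is the number of extremal leaves
of `t` on the left of its `i`-th leaf), until there is no remaining term or no remaining
extremal leaf. The remaining terms are kept on the right. -/
noncomputable def underTerm (t : Term S) (s : List (Term S)) : List (Term S) :=
  (t.comp fun i =>
      if t.IsExtremal i then s.getD (Nat.count t.IsExtremal i) Term.leaf else Term.leaf) ::
    s.drop (Nat.count t.IsExtremal t.arity)

/-- The under operation on words of terms: the terms of the second word are grafted onto the
extremal leaves of the last term of the first word. -/
noncomputable def underList : List (Term S) → List (Term S) → List (Term S)
  | [], s => s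
  | [t], s => underTerm t s
  | t :: t' :: f, s => t :: underList (t' :: f) s

theorem underList_ne_leaf (f s : List (Term S)) (hf : ∀ t ∈ f, t ≠ Term.leaf)
    (hs : ∀ t ∈ s, t ≠ Term.leaf) : ∀ t ∈ underList f s, t ≠ Term.leaf := by
  induction f with
  | nil => exact hs
  | cons t f ih =>
    cases f with
    | nil =>
      intro r hr
      rcases List.mem_cons.1 hr with rfl | hr
      · exact Term.comp_ne_leaf (hf t (by simp)) _
      · exact hs r (List.mem_of_mem_drop hr)
    | cons t' f =>
      intro r hr
      rcases List.mem_cons.1 hr with rfl | hr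
      · exact hf _ (by simp)
      · exact ih (fun x hx => hf x (List.mem_cons_of_mem _ hx)) r hr

/-- The under operation on reduced forests. -/
noncomputable def opUnder (f f' : RForest S) : RForest S :=
  ⟨underList f.1 f'.1, underList_ne_leaf f.1 f'.1 f.2 f'.2⟩

/-- The covering relation `⇀` on reduced forests. -/
def Step (f f' : RForest S) : Prop := ForestStep f.1 f'.1

/-- The multiset of decorations; auxiliary, for finiteness. -/
def content (f : RForest S) : Multiset (Σ n, S n) := (f.1.map Term.content).sum

/-- Auxiliary statistic, strictly increasing along the easterly wind order. -/
def stat (f : RForest S) : ℕ := (f.1.map Term.stat).sum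

theorem Step.content_eq [IsEmpty (S 0)] {f f' : RForest S} (h : f.Step f') :
    f'.content = f.content := by
  obtain ⟨f, hf⟩ := f
  obtain ⟨f', hf'⟩ := f'
  change ForestStep f f' at h
  cases h with
  | root p q s t => simp [content, Term.content_graftRight, add_assoc]
  | inner p q t t' h => simp [content, h.content_eq]

theorem Step.stat_lt [IsEmpty (S 0)] {f f' : RForest S} (h : f.Step f') : f.stat < f'.stat := by
  obtain ⟨f, hf⟩ := f
  obtain ⟨f', hf'⟩ := f'
  change ForestStep f f' at h
  cases h with
  | root p q s t =>
    have h1 := (Term.stat_graftRight s t).2 (hf s (by simp))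
    have h2 := Term.degree_pos (hf t (by simp))
    simp only [stat, List.map_append, List.map_cons, List.sum_append, List.sum_cons]
    omega
  | inner p q t t' h =>
    have := h.stat_lt
    simp only [stat, List.map_append, List.map_cons, List.sum_append, List.sum_cons]
    omega

theorem content_eq_of_rtg [IsEmpty (S 0)] {f f' : RForest S} (h : Relation.ReflTransGen Step f f') :
    f'.content = f.content := by
  induction h with
  | refl => rfl
  | tail _ h ih => exact h.content_eq.trans ih

theorem eq_or_stat_lt_of_rtg [IsEmpty (S 0)] {f f' : RForest S}
    (h : Relation.ReflTransGen Step f f') : f = f' ∨ f.stat < f'.stat := by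
  induction h with
  | refl => exact Or.inl rfl
  | tail _ h ih =>
    rcases ih with rfl | ih
    · exact Or.inr h.stat_lt
    · exact Or.inr (ih.trans h.stat_lt)

/-- The easterly wind order: the reflexive and transitive closure of `⇀`. -/
instance [IsEmpty (S 0)] : PartialOrder (RForest S) where
  le := Relation.ReflTransGen Step
  le_refl _ := Relation.ReflTransGen.refl
  le_trans _ _ _ := Relation.ReflTransGen.trans
  le_antisymm f g h h' := by
    rcases eq_or_stat_lt_of_rtg h with h | h
    · exact h
    · rcases eq_or_stat_lt_of_rtg h' with h' | h'
      · exact h'.symm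
      · omega

theorem length_le_card_content (f : RForest S) : f.1.length ≤ f.content.card := by
  obtain ⟨f, hf⟩ := f
  simp only [content]
  induction f with
  | nil => simp
  | cons t f ih =>
    have h1 := Term.degree_pos (hf t (by simp))
    have h2 := ih fun x hx => hf x (List.mem_cons_of_mem _ hx)
    simp only [List.map_cons, List.sum_cons, Multiset.card_add, Term.card_content,
      List.length_cons]
    omega

theorem finite_content_eq (W : Multiset (Σ n, S n)) : {f : RForest S | f.content = W}.Finite := by
  have hA := Term.finite_content_le W W.card
  have : Finite {t : Term S | t.degree ≤ W.card ∧ t.content ≤ W} := hA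
  have hL := (List.finite_length_le {t : Term S | t.degree ≤ W.card ∧ t.content ≤ W} W.card).image
    (List.map Subtype.val)
  refine Set.Finite.of_finite_image (f := Subtype.val) (hL.subset ?_) Subtype.val_injective.injOn
  rintro _ ⟨f, hf, rfl⟩
  have hmem : ∀ t ∈ f.1, t ∈ {t : Term S | t.degree ≤ W.card ∧ t.content ≤ W} := by
    intro t ht
    have : t.content ≤ W := by
      rw [← (hf : f.content = W)]
      exact List.single_le_sum (fun _ _ => Multiset.zero_le _) _ (List.mem_map_of_mem ht)
    exact ⟨by rw [← Term.card_content]; exact Multiset.card_le_card this, this⟩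
  refine ⟨f.1.pmap Subtype.mk hmem, ?_, ?_⟩
  · have := length_le_card_content f
    rw [(hf : f.content = W)] at this
    change (f.1.pmap Subtype.mk hmem).length ≤ W.card
    simpa only [List.length_pmap] using this
  · simp [List.map_pmap]

theorem finite_Ici [IsEmpty (S 0)] (f : RForest S) : (Set.Ici f).Finite :=
  (finite_content_eq f.content).subset fun _ h => content_eq_of_rtg h

theorem finite_Iic [IsEmpty (S 0)] (f : RForest S) : (Set.Iic f).Finite :=
  (finite_content_eq f.content).subset fun _ h => (content_eq_of_rtg h).symm

noncomputable instance [IsEmpty (S 0)] : LocallyFiniteOrder (RForest S) :=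
  LocallyFiniteOrder.ofFiniteIcc fun f _ => (finite_Ici f).subset fun _ h => h.1

open Classical in
noncomputable instance [IsEmpty (S 0)] : LocallyFiniteOrderTop (RForest S) :=
  LocallyFiniteOrderTop.ofIci _ (fun f => (finite_Ici f).toFinset) fun f g => by simp

open Classical in
noncomputable instance [IsEmpty (S 0)] : LocallyFiniteOrderBot (RForest S) :=
  LocallyFiniteOrderBot.ofIic _ (fun f => (finite_Iic f).toFinset) fun f g => by simp

end RForest

/-- The algebra `N·T·S`: the `K`-linear span of the reduced forests, with the product extending
concatenation bilinearly. -/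
abbrev NatAlgebra (K : Type v) [Field K] (S : ℕ → Type u) : Type (max u v) :=
  MonoidAlgebra K (RForest S)

namespace NatAlgebra

variable (K : Type v) [Field K] {S : ℕ → Type u}

/-- The elementary basis. -/
noncomputable def E (f : RForest S) : NatAlgebra K S := MonoidAlgebra.single f 1

open Classical in
/-- The fundamental basis: `F f = ∑ μ(f, f') • E f'` over all `f' ≽ f`. -/
noncomputable def F [IsEmpty (S 0)] (f : RForest S) : NatAlgebra K S :=
  ∑ f' ∈ Finset.Ici f, IncidenceAlgebra.mu K f f' • E K f'

/-- The homogeneous basis: `H f = ∑ F f'` over all `f' ≼ f`. -/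
noncomputable def H [IsEmpty (S 0)] (f : RForest S) : NatAlgebra K S :=
  ∑ f' ∈ Finset.Iic f, F K f'

end NatAlgebra

/-!
Read a forest in preorder, keeping its leaves. The rightmost leaf of a term is the last letter of
its word, so grafting `t` onto the rightmost leaf of its left brother, with a leaf left behind, just
moves a leaf to the right past the word of `t`. A leaf at the top level is immaterial.

Cutting a forest after its first `m` internal nodes in preorder is monotone for the easterly wind
order. When `m` is the number of internal nodes of `f`, the over and under operations are adjoint
to this cut: `f.opOver g ≤ h ↔ (f, g) ≤ cut m h` and `h ≤ f.opUnder g ↔ cut m h ≤ (f, g)`. Thus the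
intervals `[f.opOver g, f.opUnder g]` are the fibers of the cut. Summing `F` along these fibers
below a pair gives the product of the `H`, and above a pair it gives `E f * E g`, whence the product
of the `F` by Möbius inversion on pairs of forests.
-/

/-! ### Preorder words -/

theorem ofFn_getD_append_drop {α : Type*} (n : ℕ) (L : List α) (d : α) :
    List.ofFn (fun i : Fin n => L.getD i d) ++ L.drop n = L ++ List.replicate (n - L.length) d := by
  induction n generalizing L with
  | zero => simp
  | succ n ih =>
    cases L with
    | nil => simp [List.replicate_succ]
    | cons x L => simpa [List.ofFn_succ] using ih L

/-- Preorder words, with leaves: `none` stands for a leaf and `some ⟨n, g⟩` for an internal node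
decorated by `g : S n`. A word in which some nodes miss children is allowed. -/
abbrev PreorderWord (S : ℕ → Type u) : Type u := List (Option (Σ n, S n))

namespace Term

variable {S : ℕ → Type u}

/-- The preorder traversal of a term, leaves included. -/
def word : Term S → PreorderWord S
  | leaf => [none]
  | @node _ n g ts => some ⟨n, g⟩ :: (List.ofFn fun i => (ts i).word).flatten

theorem word_node {n : ℕ} (g : S n) (ts : Fin n → Term S) :
    (node g ts).word = some ⟨n, g⟩ :: (List.ofFn ts).flatMap word := by
  simp only [word, List.flatMap, List.map_ofFn, Function.comp_def]

/-- The term with root `g` whose children are the first terms of `L`, followed by leaves if `L` is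
too short. -/
def ofList {n : ℕ} (g : S n) (L : List (Term S)) : Term S :=
  node g fun i => L.getD i leaf

theorem ofList_ofFn_append {n : ℕ} (g : S n) (ts : Fin n → Term S) (L : List (Term S)) :
    ofList g (List.ofFn ts ++ L) = node g ts := by
  unfold ofList
  congr 1
  ext i
  simp [List.getD_eq_getElem?_getD, List.getElem?_append_left]

theorem flatMap_word_replicate_leaf (k : ℕ) :
    (List.replicate k (leaf : Term S)).flatMap word = List.replicate k none := by
  induction k with
  | zero => rfl
  | succ k ih => simp [List.replicate_succ, ih, word]

end Term

namespace PreorderWord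

open Term

variable {S : ℕ → Type u}

/-- Reads a preorder word as a word of terms; the missing children are taken to be leaves. -/
def parse : PreorderWord S → List (Term S)
  | [] => []
  | none :: w => leaf :: parse w
  | some ⟨n, g⟩ :: w => ofList g (parse w) :: (parse w).drop n

theorem parse_flatMap_word_append_of_forall {L : List (Term S)}
    (hL : ∀ t ∈ L, ∀ w, parse (t.word ++ w) = t :: parse w) (w : PreorderWord S) :
    parse (L.flatMap word ++ w) = L ++ parse w := by
  induction L with
  | nil => rfl
  | cons t L ih =>
    rw [List.forall_mem_cons] at hL
    simp only [List.flatMap_cons, List.append_assoc, hL.1, ih hL.2, List.cons_append]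

theorem parse_word_append (t : Term S) (w : PreorderWord S) :
    parse (t.word ++ w) = t :: parse w := by
  induction t generalizing w with
  | leaf => rfl
  | node g ts ih =>
    have hts := parse_flatMap_word_append_of_forall (L := List.ofFn ts) (by simpa using ih) w
    simp [word_node, parse, hts, ofList_ofFn_append]

theorem parse_flatMap_word_append (L : List (Term S)) (w : PreorderWord S) :
    parse (L.flatMap word ++ w) = L ++ parse w :=
  parse_flatMap_word_append_of_forall (fun t _ => parse_word_append t) w

theorem parse_replicate_none_append (k : ℕ) (w : PreorderWord S) :
    parse (List.replicate k none ++ w) = List.replicate k leaf ++ parse w := by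
  rw [← flatMap_word_replicate_leaf, parse_flatMap_word_append]

theorem exists_flatMap_word_parse (w : PreorderWord S) :
    ∃ r, (parse w).flatMap word = w ++ List.replicate r none := by
  induction w with
  | nil => exact ⟨0, rfl⟩
  | cons a w ih =>
    obtain ⟨r, hr⟩ := ih
    obtain _ | ⟨n, g⟩ := a
    · exact ⟨r, by simp [parse, hr, word]⟩
    · refine ⟨r + (n - (parse w).length), ?_⟩
      simp only [parse, ofList, List.flatMap_cons, word_node, List.cons_append,
        ← List.flatMap_append, ofFn_getD_append_drop]
      rw [List.flatMap_append, hr, flatMap_word_replicate_leaf, List.append_assoc,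
        List.replicate_append_replicate]

theorem exists_parse_append_replicate_none (w : PreorderWord S) (r : ℕ) :
    ∃ k, parse (w ++ List.replicate r none) = parse w ++ List.replicate k leaf := by
  induction w with
  | nil => exact ⟨r, by simpa [parse] using parse_replicate_none_append (S := S) r []⟩
  | cons a w ih =>
    obtain ⟨k, hk⟩ := ih
    obtain _ | ⟨n, g⟩ := a
    · exact ⟨k, by simp [parse, hk]⟩
    · refine ⟨k - (n - (parse w).length), ?_⟩
      have hpad (i : ℕ) : (parse w ++ List.replicate k leaf).getD i leaf
          = (parse w).getD i leaf := by
        simp only [List.getD_eq_getElem?_getD, List.getElem?_append, List.getElem?_replicate]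
        split_ifs <;> simp_all
      simp only [List.cons_append, parse, hk, ofList, hpad, List.drop_append, List.drop_replicate]

end PreorderWord

namespace RForest

open Term PreorderWord

variable {S : ℕ → Type u}

/-- The preorder traversal of a reduced forest, leaves included. -/
def word (f : RForest S) : PreorderWord S := f.1.flatMap Term.word

theorem word_mul (f g : RForest S) : (f * g).word = f.word ++ g.word :=
  List.flatMap_append

open Classical in
/-- The reduced forest obtained by removing the terms of a word equal to the leaf. -/
noncomputable def reduce (L : List (Term S)) : RForest S :=
  ⟨L.filter (· ≠ leaf), by simp⟩

theorem reduce_append (L M : List (Term S)) : reduce (L ++ M) = reduce L * reduce M :=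
  Subtype.ext (List.filter_append ..)

theorem reduce_leaf_cons (L : List (Term S)) : reduce (leaf :: L) = reduce L :=
  Subtype.ext (by simp [reduce])

theorem coe_reduce_cons {t : Term S} (ht : t ≠ leaf) (L : List (Term S)) :
    (reduce (t :: L)).1 = t :: (reduce L).1 := by
  simp [reduce, ht]

theorem reduce_replicate_leaf (k : ℕ) : reduce (List.replicate k (leaf : Term S)) = 1 :=
  Subtype.ext (by simp [reduce]; rfl)

theorem reduce_val (f : RForest S) : reduce f.1 = f :=
  Subtype.ext (List.filter_eq_self.2 (by simpa using f.2))

/-- The reduced forest encoded by a preorder word. -/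
noncomputable def read (w : PreorderWord S) : RForest S := reduce (parse w)

theorem read_flatMap_word_append (L : List (Term S)) (w : PreorderWord S) :
    read (L.flatMap Term.word ++ w) = reduce L * read w := by
  rw [read, parse_flatMap_word_append, reduce_append, read]

theorem read_word_append (f : RForest S) (w : PreorderWord S) :
    read (f.word ++ w) = f * read w := by
  rw [word, read_flatMap_word_append, reduce_val]

theorem read_nil : read ([] : PreorderWord S) = 1 := rfl

theorem read_word (f : RForest S) : read f.word = f := by
  simpa [read_nil] using read_word_append f []

theorem read_append_replicate_none (w : PreorderWord S) (r : ℕ) :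
    read (w ++ List.replicate r none) = read w := by
  obtain ⟨k, hk⟩ := exists_parse_append_replicate_none w r
  rw [read, hk, reduce_append, reduce_replicate_leaf, mul_one, read]

theorem read_replicate_none_append (r : ℕ) (w : PreorderWord S) :
    read (List.replicate r none ++ w) = read w := by
  rw [read, parse_replicate_none_append, reduce_append, reduce_replicate_leaf, one_mul, read]

end RForest

/-! ### The easterly wind order on preorder words -/

theorem getD_append_cons_eq_update {α : Type*} (p q : List α) (x y d : α) {n : ℕ} (i : Fin n)
    (hi : p.length = i) :
    (fun k : Fin n => (p ++ y :: q).getD k d)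
      = Function.update (fun k : Fin n => (p ++ x :: q).getD k d) i y := by
  ext k
  have : k = i ↔ (k : ℕ) = i := Fin.ext_iff
  grind [Function.update_apply]

namespace Term

variable {S : ℕ → Type u}

theorem ofList_concat_graftRight (p : List (Term S)) (g : S (p.length + 1)) (s t : Term S) :
    ofList g (p ++ [s.graftRight t]) = (ofList g (p ++ [s])).graftRight t := by
  rw [ofList, ofList, graftRight]
  congr 1
  grind

theorem Step.ofList_slide {n : ℕ} (g : S n) (p q : List (Term S)) (s : Term S) {t : Term S}
    (ht : t ≠ leaf) (hn : p.length + 1 < n) :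
    (ofList g (p ++ s :: t :: q)).Step (ofList g (p ++ s.graftRight t :: leaf :: q)) := by
  have hs := getD_append_cons_eq_update p (t :: q) s (s.graftRight t) leaf
    (⟨p.length, by omega⟩ : Fin n) rfl
  have ht' := getD_append_cons_eq_update (p ++ [s.graftRight t]) q t leaf leaf
    (⟨p.length + 1, hn⟩ : Fin n) (by simp)
  simp only [List.append_assoc, List.cons_append, List.nil_append] at ht'
  have hstep := Step.slide g (fun k : Fin n => (p ++ s :: t :: q).getD k leaf)
    ⟨p.length, by omega⟩ ⟨p.length + 1, hn⟩ rfl (by simpa)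
  simp only [ofList, ht', hs]
  simpa using hstep

theorem Step.ofList_inner {n : ℕ} (g : S n) (p q : List (Term S)) {t t' : Term S}
    (h : t.Step t') (hn : p.length < n) :
    (ofList g (p ++ t :: q)).Step (ofList g (p ++ t' :: q)) := by
  have ht := getD_append_cons_eq_update p q t t' leaf (⟨p.length, hn⟩ : Fin n) rfl
  have hstep := Step.child g (fun k : Fin n => (p ++ t :: q).getD k leaf) ⟨p.length, hn⟩ t'
    (by simpa)
  rwa [ofList, ofList, ht]

theorem ofList_append_of_le {n : ℕ} (g : S n) (p q : List (Term S)) (hn : n ≤ p.length) :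
    ofList g (p ++ q) = ofList g p := by
  unfold ofList
  congr 1
  grind

end Term

/-- The covering relation on words of terms in which the leaves are kept: a term which is moved
leaves a leaf at its place, even if it stands at the top level. -/
inductive BrotherStep {S : ℕ → Type u} : List (Term S) → List (Term S) → Prop
  | slide (p q : List (Term S)) (s : Term S) {t : Term S} (ht : t ≠ Term.leaf) :
      BrotherStep (p ++ s :: t :: q) (p ++ s.graftRight t :: Term.leaf :: q)
  | inner (p q : List (Term S)) {t t' : Term S} (h : t.Step t') :
      BrotherStep (p ++ t :: q) (p ++ t' :: q)

namespace BrotherStep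

open Term

variable {S : ℕ → Type u} {L M : List (Term S)}

theorem cons (t : Term S) (h : BrotherStep L M) : BrotherStep (t :: L) (t :: M) := by
  cases h with
  | slide p q s ht => exact slide (t :: p) q s ht
  | inner p q h => exact inner (t :: p) q h

/-- In a preorder word, prepending the symbol `g` collects the first terms as children of `g`.
The last child and the next root of the remaining word are brothers before `g` is prepended and
not after, but then this next root becomes the right brother of `g`, whose rightmost leaf is that
of its last child. -/
theorem collect {n : ℕ} (g : S n) (h : BrotherStep L M) :
    BrotherStep (ofList g L :: L.drop n) (ofList g M :: M.drop n) := by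
  cases h with
  | @slide p q s t ht =>
    rcases lt_trichotomy (p.length + 1) n with hn | rfl | hn
    · obtain ⟨k, rfl⟩ := Nat.exists_eq_add_of_lt hn
      simpa only [List.nil_append, add_assoc, List.drop_length_add_append, List.drop_succ_cons,
        Nat.add_comm 1] using inner [] (q.drop k) (Step.ofList_slide g p q s ht hn)
    · have hL (x y : Term S) : ofList g (p ++ x :: y :: q) = ofList g (p ++ [x]) := by
        simpa using ofList_append_of_le g (p ++ [x]) (y :: q) (by simp)
      rw [hL, hL, ofList_concat_graftRight]
      simpa only [List.nil_append, List.drop_length_add_append, List.drop_succ_cons, List.drop_zero]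
        using slide [] q (ofList g (p ++ [s])) ht
    · have hp : n ≤ p.length := by omega
      simpa only [ofList_append_of_le g p _ hp, List.drop_append_of_le_length hp, List.cons_append]
        using slide (ofList g p :: p.drop n) q s ht
  | inner p q h =>
    rcases lt_or_ge p.length n with hn | hn
    · obtain ⟨k, rfl⟩ := Nat.exists_eq_add_of_lt hn
      simpa only [List.nil_append, add_assoc, List.drop_length_add_append, List.drop_succ_cons]
        using inner [] (q.drop k) (h.ofList_inner g p q hn)
    · simpa only [ofList_append_of_le g p _ hn, List.drop_append_of_le_length hn, List.cons_append]
        using inner (ofList g p :: p.drop n) q h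

theorem parse (u : PreorderWord S) {t : Term S} (ht : t ≠ leaf) (z : PreorderWord S) :
    BrotherStep (PreorderWord.parse (u ++ none :: (t.word ++ z)))
      (PreorderWord.parse (u ++ (t.word ++ none :: z))) := by
  induction u with
  | nil =>
    simpa only [List.nil_append, PreorderWord.parse, PreorderWord.parse_word_append, graftRight]
      using slide [] (PreorderWord.parse z) leaf ht
  | cons a u ih =>
    obtain _ | ⟨n, g⟩ := a
    · exact ih.cons leaf
    · exact ih.collect g

theorem reduce_le [IsEmpty (S 0)] (h : BrotherStep L M) :
    RForest.reduce L ≤ RForest.reduce M := by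
  cases h with
  | @slide p q s t ht =>
    rw [RForest.reduce_append, RForest.reduce_append]
    by_cases hs : s = leaf
    · simp [hs, graftRight, RForest.reduce, ht]
    · have hst : s.graftRight t ≠ leaf := by cases s <;> simp_all [graftRight]
      have hstep := ForestStep.root (RForest.reduce p).1 (RForest.reduce q).1 s t
      refine .single (show ForestStep (_ ++ _) (_ ++ _) from ?_)
      simpa only [RForest.coe_reduce_cons hs, RForest.coe_reduce_cons ht,
        RForest.coe_reduce_cons hst, RForest.reduce_leaf_cons] using hstep
  | @inner p q t t' h =>
    have hstep := ForestStep.inner (RForest.reduce p).1 (RForest.reduce q).1 t t' h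
    have ht : t ≠ leaf := by rintro rfl; cases h
    have ht' : t' ≠ leaf := by rintro rfl; cases h
    rw [RForest.reduce_append, RForest.reduce_append]
    refine .single (show ForestStep (_ ++ _) (_ ++ _) from ?_)
    simpa only [RForest.coe_reduce_cons ht, RForest.coe_reduce_cons ht'] using hstep

end BrotherStep

theorem ofFn_update {α : Type*} {n : ℕ} (ts : Fin n → α) (i : Fin n) (t : α) :
    List.ofFn (Function.update ts i t)
      = (List.ofFn ts).take i ++ t :: (List.ofFn ts).drop (i + 1) := by
  rw [List.ofFn_eq_map, (List.nodup_finRange n).map_update, if_pos (List.mem_finRange i),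
    List.idxOf_finRange, ← List.ofFn_eq_map, List.set_eq_take_append_cons_drop,
    if_pos (by simp)]

theorem exists_ofFn_update {α : Type*} {n : ℕ} (ts : Fin n → α) (i : Fin n) :
    ∃ p q, p.length = (i : ℕ) ∧ ∀ t, List.ofFn (Function.update ts i t) = p ++ t :: q :=
  ⟨_, _, by simp [i.isLt.le], ofFn_update ts i⟩

theorem exists_ofFn_update_update {α : Type*} {n : ℕ} (ts : Fin n → α) {i j : Fin n}
    (hij : (i : ℕ) + 1 = j) :
    ∃ p q, ∀ s t, List.ofFn (Function.update (Function.update ts i s) j t) = p ++ s :: t :: q := by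
  obtain ⟨p, q, hp, hts⟩ := exists_ofFn_update ts i
  refine ⟨p, q.drop 1, fun s t => ?_⟩
  rw [ofFn_update, hts, ← hij, ← hp, add_assoc, List.take_length_add_append,
    List.drop_length_add_append]
  simp

theorem Term.exists_word_graftRight {S : ℕ → Type u} [IsEmpty (S 0)] (s : Term S) :
    ∃ u, s.word = u ++ [none] ∧ ∀ t, (s.graftRight t).word = u ++ t.word := by
  induction s with
  | leaf => exact ⟨[], rfl, fun _ => rfl⟩
  | @node n g ts ih =>
    obtain _ | n := n
    · exact isEmptyElim g
    · obtain ⟨u, hu, hut⟩ := ih (Fin.last n)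
      refine ⟨some ⟨n + 1, g⟩ :: ((List.ofFn fun i : Fin n => ts i.castSucc).flatMap word ++ u),
        ?_, fun t => ?_⟩
      · rw [word_node, List.ofFn_succ_last]
        simp [hu]
      · have hne (i : Fin n) : (i : ℕ) ≠ n := i.isLt.ne
        rw [graftRight, word_node, List.ofFn_succ_last]
        simp [hut, hne]

namespace PreorderWord

variable {S : ℕ → Type u}

/-- The covering relation of the easterly wind order, read on preorder words: a leaf moves to the
right past a term. -/
inductive Slide : PreorderWord S → PreorderWord S → Prop
  | mk (u : PreorderWord S) (t : Term S) (z : PreorderWord S) :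
      Slide (u ++ none :: (t.word ++ z)) (u ++ (t.word ++ none :: z))

namespace Slide

open Term

theorem append_append {w w' : PreorderWord S} (h : Slide w w') (x y : PreorderWord S) :
    Slide (x ++ (w ++ y)) (x ++ (w' ++ y)) := by
  obtain ⟨u, t, z⟩ := h
  simpa only [List.append_assoc, List.cons_append] using mk (x ++ u) t (z ++ y)

theorem none_flatMap_word (u : PreorderWord S) (L : List (Term S)) (z : PreorderWord S) :
    Relation.ReflTransGen Slide (u ++ none :: (L.flatMap word ++ z))
      (u ++ (L.flatMap word ++ none :: z)) := by
  induction L generalizing u with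
  | nil => exact .refl
  | cons t L ih =>
    refine .head (by simpa using mk u t (L.flatMap word ++ z)) ?_
    simpa using ih (u ++ t.word)

theorem graftRight [IsEmpty (S 0)] (x : PreorderWord S) (s t : Term S) (y : PreorderWord S) :
    Slide (x ++ (s.word ++ (t.word ++ y))) (x ++ ((s.graftRight t).word ++ none :: y)) := by
  obtain ⟨u, hs, hst⟩ := s.exists_word_graftRight
  simpa [hs, hst] using mk (x ++ u) t y

theorem of_step [IsEmpty (S 0)] {t t' : Term S} (h : t.Step t') : Slide t.word t'.word := by
  induction h with
  | @slide n g ts i j hij _ =>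
    obtain ⟨p, q, hpq⟩ := exists_ofFn_update_update ts hij
    have hts : List.ofFn ts = p ++ ts i :: ts j :: q := by
      rw [← hpq, Function.update_eq_self, Function.update_eq_self]
    rw [word_node, word_node, hpq, hts]
    simpa [word] using graftRight (some ⟨n, g⟩ :: p.flatMap word) (ts i) (ts j) (q.flatMap word)
  | @child n g ts i t' _ ih =>
    obtain ⟨p, q, -, hpq⟩ := exists_ofFn_update ts i
    have hts : List.ofFn ts = p ++ ts i :: q := by rw [← hpq, Function.update_eq_self]
    rw [word_node, word_node, hpq, hts]
    simpa using ih.append_append (some ⟨n, g⟩ :: p.flatMap word) (q.flatMap word)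

theorem of_forestStep [IsEmpty (S 0)] {L M : List (Term S)} (h : ForestStep L M) :
    ∃ r, Relation.ReflTransGen Slide (L.flatMap word)
      (M.flatMap word ++ List.replicate r none) := by
  cases h with
  | root p q s t =>
    refine ⟨1, .head (by simpa using graftRight (p.flatMap word) s t (q.flatMap word)) ?_⟩
    simpa using none_flatMap_word (p.flatMap word ++ (s.graftRight t).word) q []
  | inner p q t t' h =>
    refine ⟨0, .single ?_⟩
    simpa using (of_step h).append_append (p.flatMap word) (q.flatMap word)

theorem read_le [IsEmpty (S 0)] {w w' : PreorderWord S} (h : Slide w w') :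
    RForest.read w ≤ RForest.read w' := by
  obtain ⟨u, t, z⟩ := h
  by_cases ht : t = leaf
  · simp [ht, word]
  · exact (BrotherStep.parse u ht z).reduce_le

theorem le_of_reflTransGen {α : Type*} [Preorder α] {Φ : PreorderWord S → α}
    (hΦ : ∀ {w w'}, Slide w w' → Φ w ≤ Φ w') {w w' : PreorderWord S}
    (h : Relation.ReflTransGen Slide w w') : Φ w ≤ Φ w' := by
  induction h with
  | refl => exact le_rfl
  | tail _ h ih => exact ih.trans (hΦ h)

end Slide

theorem map_append_replicate_none_append_le {α : Type*} [Preorder α] {Φ : PreorderWord S → α}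
    (hΦ : ∀ u w, Φ (u ++ none :: w) ≤ Φ (u ++ w)) (u : PreorderWord S) (r : ℕ)
    (w : PreorderWord S) : Φ (u ++ (List.replicate r none ++ w)) ≤ Φ (u ++ w) := by
  induction r with
  | zero => exact le_rfl
  | succ r ih => exact (hΦ u _).trans ih

end PreorderWord

namespace RForest

open PreorderWord

variable {S : ℕ → Type u} [IsEmpty (S 0)]

theorem monotone_of_slide {α : Type*} [Preorder α] {Φ : PreorderWord S → α}
    (hslide : ∀ {w w'}, Slide w w' → Φ w ≤ Φ w')
    (hnone : ∀ u w, Φ (u ++ none :: w) ≤ Φ (u ++ w)) :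
    Monotone fun f : RForest S => Φ f.word := by
  intro f g h
  induction h with
  | refl => exact le_rfl
  | @tail _ g _ h ih =>
    obtain ⟨r, hr⟩ := Slide.of_forestStep h
    have hpad := map_append_replicate_none_append_le hnone g.word r []
    rw [List.append_nil, List.append_nil] at hpad
    exact ih.trans ((Slide.le_of_reflTransGen hslide hr).trans hpad)

end RForest

/-! ### Cutting a preorder word -/

namespace PreorderWord

variable {S : ℕ → Type u}

/-- The number of internal nodes of a preorder word. -/
def nodeCount (w : PreorderWord S) : ℕ := w.countP Option.isSome

theorem nodeCount_nil : nodeCount ([] : PreorderWord S) = 0 := rfl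

theorem nodeCount_none_cons (w : PreorderWord S) : nodeCount (none :: w) = nodeCount w := by
  simp [nodeCount]

theorem nodeCount_some_cons (a : Σ n, S n) (w : PreorderWord S) :
    nodeCount (some a :: w) = nodeCount w + 1 := by
  simp [nodeCount]

theorem nodeCount_append (u w : PreorderWord S) :
    nodeCount (u ++ w) = nodeCount u + nodeCount w :=
  List.countP_append ..

theorem nodeCount_append_none_cons (u w : PreorderWord S) :
    nodeCount (u ++ none :: w) = nodeCount (u ++ w) := by
  simp only [nodeCount_append, nodeCount_none_cons]

theorem nodeCount_replicate_none (r : ℕ) :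
    nodeCount (List.replicate r none : PreorderWord S) = 0 := by
  simp [nodeCount, List.countP_replicate]

/-- The shortest prefix of a preorder word with `m` internal nodes, or the whole word if it has
fewer of them. -/
def takeNodes : ℕ → PreorderWord S → PreorderWord S
  | 0, _ => []
  | _ + 1, [] => []
  | m + 1, none :: w => none :: takeNodes (m + 1) w
  | m + 1, some a :: w => some a :: takeNodes m w

/-- What remains of a preorder word after the removal of `takeNodes m`. -/
def dropNodes : ℕ → PreorderWord S → PreorderWord S
  | 0, w => w
  | _ + 1, [] => []
  | m + 1, none :: w => dropNodes (m + 1) w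
  | m + 1, some _ :: w => dropNodes m w

theorem takeNodes_zero (w : PreorderWord S) : takeNodes 0 w = [] := by simp [takeNodes]

theorem dropNodes_zero (w : PreorderWord S) : dropNodes 0 w = w := by simp [dropNodes]

theorem takeNodes_append_dropNodes (m : ℕ) (w : PreorderWord S) :
    takeNodes m w ++ dropNodes m w = w := by
  fun_induction takeNodes m w <;> simp_all [dropNodes]

theorem takeNodes_append (m : ℕ) (u w : PreorderWord S) :
    takeNodes m (u ++ w) = takeNodes m u ++ takeNodes (m - nodeCount u) w := by
  fun_induction takeNodes m u <;>
    simp_all [takeNodes, nodeCount_nil, nodeCount_none_cons, nodeCount_some_cons]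

theorem dropNodes_append (m : ℕ) (u w : PreorderWord S) :
    dropNodes m (u ++ w) = dropNodes m u ++ dropNodes (m - nodeCount u) w := by
  fun_induction dropNodes m u <;>
    simp_all [dropNodes, nodeCount_nil, nodeCount_none_cons, nodeCount_some_cons]

theorem dropNodes_of_lt {m : ℕ} {w : PreorderWord S} (h : nodeCount w < m) :
    dropNodes m w = [] := by
  fun_induction dropNodes m w <;> simp_all [nodeCount_none_cons, nodeCount_some_cons]

theorem takeNodes_of_lt {m : ℕ} {w : PreorderWord S} (h : nodeCount w < m) :
    takeNodes m w = w := by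
  simpa [dropNodes_of_lt h] using takeNodes_append_dropNodes m w

theorem nodeCount_takeNodes (m : ℕ) (w : PreorderWord S) :
    nodeCount (takeNodes m w) = min m (nodeCount w) := by
  fun_induction takeNodes m w <;>
    simp_all [nodeCount_nil, nodeCount_none_cons, nodeCount_some_cons]

theorem dropNodes_takeNodes (m : ℕ) (w : PreorderWord S) : dropNodes m (takeNodes m w) = [] := by
  fun_induction takeNodes m w <;> simp_all [dropNodes]

theorem takeNodes_takeNodes (m : ℕ) (w : PreorderWord S) :
    takeNodes m (takeNodes m w) = takeNodes m w := by
  simpa [dropNodes_takeNodes] using takeNodes_append_dropNodes m (takeNodes m w)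

theorem exists_dropNodes_nodeCount (w : PreorderWord S) :
    ∃ k, dropNodes (nodeCount w) w = List.replicate k none := by
  induction w with
  | nil => exact ⟨0, rfl⟩
  | cons a w ih =>
    obtain ⟨k, hk⟩ := ih
    obtain _ | a := a
    · rw [nodeCount_none_cons]
      obtain h | h := Nat.eq_zero_or_pos (nodeCount w)
      · exact ⟨k + 1, by simpa [h, dropNodes, List.replicate_succ] using hk⟩
      · obtain ⟨m, hm⟩ := Nat.exists_eq_add_one.2 h
        exact ⟨k, by simpa [hm, dropNodes] using hk⟩
    · exact ⟨k, by simpa [nodeCount_some_cons, dropNodes] using hk⟩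

theorem Slide.nodeCount_eq {w w' : PreorderWord S} (h : Slide w w') :
    nodeCount w = nodeCount w' := by
  obtain ⟨u, t, z⟩ := h
  simp only [nodeCount_append, nodeCount_none_cons]

theorem exists_dropNodes_flatMap_word_of_forall {L : List (Term S)}
    (hL : ∀ t ∈ L, ∀ m, ∃ M : List (Term S), dropNodes m t.word = M.flatMap Term.word) (m : ℕ) :
    ∃ M : List (Term S), dropNodes m (L.flatMap Term.word) = M.flatMap Term.word := by
  induction L generalizing m with
  | nil => exact ⟨[], by cases m <;> rfl⟩
  | cons t L ih =>
    rw [List.forall_mem_cons] at hL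
    obtain ⟨M, hM⟩ := hL.1 m
    obtain ⟨N, hN⟩ := ih hL.2 (m - nodeCount t.word)
    exact ⟨M ++ N, by rw [List.flatMap_cons, dropNodes_append, hM, hN, List.flatMap_append]⟩

theorem exists_dropNodes_word (t : Term S) (m : ℕ) :
    ∃ M : List (Term S), dropNodes m t.word = M.flatMap Term.word := by
  induction t generalizing m with
  | leaf => cases m with
    | zero => exact ⟨[.leaf], rfl⟩
    | succ m => exact ⟨[], rfl⟩
  | node g ts ih =>
    cases m with
    | zero => exact ⟨[.node g ts], by simp [dropNodes_zero]⟩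
    | succ m =>
      rw [Term.word_node, dropNodes]
      exact exists_dropNodes_flatMap_word_of_forall (by simpa using ih) m

end PreorderWord

namespace RForest

open PreorderWord

variable {S : ℕ → Type u}

theorem word_reduce_cons {t : Term S} (ht : t ≠ .leaf) (L : List (Term S)) :
    (reduce (t :: L)).word = t.word ++ (reduce L).word := by
  rw [word, coe_reduce_cons ht, List.flatMap_cons, word]

theorem le_map_word_reduce {α : Type*} [Preorder α] {Φ : PreorderWord S → α}
    (hΦ : ∀ u w, Φ (u ++ none :: w) ≤ Φ (u ++ w)) (u : PreorderWord S) (L : List (Term S)) :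
    Φ (u ++ L.flatMap Term.word) ≤ Φ (u ++ (reduce L).word) := by
  induction L generalizing u with
  | nil => exact le_rfl
  | cons t L ih =>
    by_cases ht : t = .leaf
    · simpa [ht, Term.word, reduce_leaf_cons] using (hΦ u _).trans (ih u)
    · simpa [word_reduce_cons ht] using ih (u ++ t.word)

/-- The number of internal nodes of a reduced forest. -/
def degree (f : RForest S) : ℕ := nodeCount f.word

theorem degree_read (w : PreorderWord S) : (read w).degree = nodeCount w := by
  obtain ⟨r, hr⟩ := exists_flatMap_word_parse w
  have hle := le_map_word_reduce (Φ := nodeCount)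
    (fun u w => (nodeCount_append_none_cons u w).le) [] (parse w)
  have hge := le_map_word_reduce (Φ := fun w => OrderDual.toDual (nodeCount w))
    (fun u w => (nodeCount_append_none_cons u w).ge) [] (parse w)
  have hw : nodeCount ((parse w).flatMap Term.word) = nodeCount w := by
    rw [hr, nodeCount_append, nodeCount_replicate_none, add_zero]
  rw [← hw]
  exact le_antisymm hge hle

variable [IsEmpty (S 0)]

theorem degree_eq_of_le {f g : RForest S} (h : f ≤ g) : f.degree = g.degree :=
  le_antisymm
    (monotone_of_slide (fun h => h.nodeCount_eq.le) (fun u w => (nodeCount_append_none_cons u w).le)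
      h)
    (monotone_of_slide (α := ℕᵒᵈ) (Φ := fun w => OrderDual.toDual (nodeCount w))
      (fun h => h.nodeCount_eq.ge) (fun u w => (nodeCount_append_none_cons u w).ge) h)

/-- The removed leaf can be moved to the end of the word, where it is immaterial. -/
theorem read_append_none_cons_le (u w : PreorderWord S) :
    read (u ++ none :: w) ≤ read (u ++ w) := by
  obtain ⟨r, hr⟩ := exists_flatMap_word_parse w
  have hslide := Slide.le_of_reflTransGen Slide.read_le (Slide.none_flatMap_word u (parse w) [])
  rw [hr] at hslide
  have hleft := read_append_replicate_none (u ++ none :: w) r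
  have hright := read_append_replicate_none (u ++ w) (r + 1)
  rw [← hleft, ← hright, List.replicate_add]
  simpa using hslide

theorem read_mul_read_le (u w : PreorderWord S) : read u * read w ≤ read (u ++ w) := by
  obtain ⟨r, hr⟩ := exists_flatMap_word_parse u
  calc read u * read w = read ((parse u).flatMap Term.word ++ w) := by
        rw [read_flatMap_word_append, read]
    _ = read (u ++ (List.replicate r none ++ w)) := by rw [hr, List.append_assoc]
    _ ≤ read (u ++ w) :=
        map_append_replicate_none_append_le read_append_none_cons_le u r w

theorem read_append_le_read_append_word (u w : PreorderWord S) :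
    read (u ++ w) ≤ read (u ++ (read w).word) := by
  obtain ⟨r, hr⟩ := exists_flatMap_word_parse w
  rw [← read_append_replicate_none (u ++ w) r, List.append_assoc, ← hr]
  exact le_map_word_reduce read_append_none_cons_le u (parse w)

end RForest

/-! ### The under operation on preorder words -/

theorem count_eq_sub {p : ℕ → Prop} [DecidablePred p] {a b : ℕ}
    (hp : ∀ i, p i ↔ a ≤ i ∧ i < b) {n : ℕ} (hn : n ≤ b) : Nat.count p n = n - a := by
  induction n with
  | zero => simp
  | succ n ih =>
    rw [Nat.count_succ, ih (by omega)]
    split_ifs with h <;> rw [hp] at h <;> omega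

namespace PreorderWord

variable {S : ℕ → Type u}

/-- The number of leaves of a preorder word. -/
def leafCount (w : PreorderWord S) : ℕ := w.countP Option.isNone

theorem leafCount_append (u w : PreorderWord S) :
    leafCount (u ++ w) = leafCount u + leafCount w :=
  List.countP_append ..

theorem leafCount_replicate_none (r : ℕ) :
    leafCount (List.replicate r none : PreorderWord S) = r := by
  simp [leafCount, List.countP_replicate]

/-- The substitution of `σ i` for the `i`-th leaf of a preorder word (numbered from `0`). -/
def substLeaves : (ℕ → PreorderWord S) → PreorderWord S → PreorderWord S
  | _, [] => []
  | σ, none :: w => σ 0 ++ substLeaves (fun i => σ (i + 1)) w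
  | σ, some a :: w => some a :: substLeaves σ w

theorem substLeaves_append (σ : ℕ → PreorderWord S) (u w : PreorderWord S) :
    substLeaves σ (u ++ w)
      = substLeaves σ u ++ substLeaves (fun i => σ (leafCount u + i)) w := by
  fun_induction substLeaves σ u <;>
    simp_all [substLeaves, leafCount, add_right_comm _ 1]

theorem substLeaves_eq_self {σ : ℕ → PreorderWord S} {w : PreorderWord S}
    (h : ∀ i < leafCount w, σ i = [none]) : substLeaves σ w = w := by
  fun_induction substLeaves σ w <;> simp_all [leafCount]

theorem substLeaves_replicate_none (σ : ℕ → PreorderWord S) (r : ℕ) :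
    substLeaves σ (List.replicate r none) = (List.ofFn fun i : Fin r => σ i).flatten := by
  induction r generalizing σ with
  | zero => rfl
  | succ r ih => simp [List.replicate_succ, substLeaves, ih]

theorem exists_eq_append_none_cons {w : PreorderWord S} {i : ℕ} (hi : i < leafCount w) :
    ∃ u z, w = u ++ none :: z ∧ leafCount u = i := by
  induction w generalizing i with
  | nil => simp [leafCount] at hi
  | cons a w ih =>
    obtain _ | a := a
    · obtain _ | i := i
      · exact ⟨[], w, rfl, rfl⟩
      · obtain ⟨u, z, rfl, rfl⟩ := ih (i := i) (by simpa [leafCount] using hi)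
        exact ⟨none :: u, z, rfl, by simp [leafCount]⟩
    · obtain ⟨u, z, rfl, rfl⟩ := ih (i := i) (by simpa [leafCount] using hi)
      exact ⟨some a :: u, z, rfl, by simp [leafCount]⟩

theorem reduceOption_eq_nil_iff {w : PreorderWord S} : w.reduceOption = [] ↔ nodeCount w = 0 := by
  simp [nodeCount, List.reduceOption, List.filterMap_eq_nil_iff, List.countP_eq_zero]

end PreorderWord

namespace Term

open PreorderWord

variable {S : ℕ → Type u}

theorem leafCount_word (t : Term S) : leafCount t.word = t.arity := by
  induction t with
  | leaf => rfl
  | node g ts ih =>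
    simp only [leafCount] at ih
    simp [word_node, leafCount, List.countP_flatMap, List.map_ofFn, Function.comp_def, ih, arity,
      List.sum_ofFn]

theorem word_comp_of_forall {n : ℕ} (ts : Fin n → Term S)
    (hts : ∀ k σ, ((ts k).comp σ).word = substLeaves (fun i => (σ i).word) (ts k).word)
    (σ : ℕ → Term S) :
    (List.ofFn fun k => (ts k).comp fun i =>
        σ ((∑ j : Fin k, (ts (j.castLE k.isLt.le)).arity) + i)).flatMap word
      = substLeaves (fun i => (σ i).word) ((List.ofFn ts).flatMap word) := by
  induction n with
  | zero => simp [substLeaves]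
  | succ n ih =>
    have hcount : leafCount ((List.ofFn fun k : Fin n => ts k.castSucc).flatMap word)
        = ∑ k : Fin n, (ts k.castSucc).arity := by
      simp [leafCount, List.countP_flatMap, List.map_ofFn, Function.comp_def, ← leafCount_word,
        List.sum_ofFn]
    rw [List.ofFn_succ_last (f := ts), List.flatMap_append, substLeaves_append, hcount,
      ← ih (fun k => ts k.castSucc) (fun k => hts k.castSucc), List.ofFn_succ_last,
      List.flatMap_append, List.flatMap_singleton, List.flatMap_singleton, hts]
    rfl

theorem word_comp (t : Term S) (σ : ℕ → Term S) :
    (t.comp σ).word = substLeaves (fun i => (σ i).word) t.word := by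
  induction t generalizing σ with
  | leaf => simp [comp, word, substLeaves]
  | node g ts ih => rw [comp, word_node, word_node, substLeaves, word_comp_of_forall ts ih]

theorem word_partialComp {t : Term S} {u z : PreorderWord S} (ht : t.word = u ++ none :: z)
    (s : Term S) : (t.partialComp (leafCount u) s).word = u ++ (s.word ++ z) := by
  rw [partialComp, word_comp, ht, substLeaves_append, substLeaves]
  congr 1
  · exact substLeaves_eq_self fun i hi => by simp [hi.ne, word]
  · simp only [add_zero, if_true]
    congr 1
    exact substLeaves_eq_self fun i _ => by simp [word]

theorem word_map {S' : ℕ → Type v} (φ : ∀ n, S n → S' n) (t : Term S) :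
    (t.map φ).word = t.word.map (Option.map (Sigma.map id φ)) := by
  induction t with
  | leaf => rfl
  | node g ts ih =>
    simp [map, word, ih, List.map_flatten, List.map_ofFn, Function.comp_def, Sigma.map]

theorem preorder_eq_reduceOption (t : Term S) : t.preorder = t.word.reduceOption := by
  induction t with
  | leaf => rfl
  | node g ts ih =>
    simp [preorder, word, ih, List.reduceOption, List.filterMap_flatten, List.map_ofFn,
      Function.comp_def]

theorem map_base_ne_const (a : Σ n, S n) :
    Sigma.map id (fun _ => WithConst.base) a ≠ (⟨0, WithConst.const⟩ : Σ n, WithConst S n) := by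
  obtain ⟨n, g⟩ := a
  intro h
  obtain ⟨rfl, h⟩ := Sigma.mk.inj_iff.1 h
  cases h

theorem isExtremal_leafCount_iff {t : Term S} {u z : PreorderWord S}
    (ht : t.word = u ++ none :: z) : t.IsExtremal (leafCount u) ↔ nodeCount z = 0 := by
  have hlt : leafCount u < t.arity := by
    simp [← leafCount_word, ht, leafCount]
  have hword := word_partialComp (t := t.map fun _ => WithConst.base)
    (u := u.map (Option.map (Sigma.map id fun _ => WithConst.base)))
    (z := z.map (Option.map (Sigma.map id fun _ => WithConst.base)))
    (by simp [word_map, ht]) (node WithConst.const Fin.elim0)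
  have hcount : leafCount (u.map (Option.map (Sigma.map id fun _ => WithConst.base)))
      = leafCount u := by
    simp [leafCount, List.countP_map, Function.comp_def]
  rw [hcount] at hword
  rw [IsExtremal, and_iff_right hlt, preorder_eq_reduceOption, hword, ← reduceOption_eq_nil_iff]
  rcases List.eq_nil_or_concat' z.reduceOption with hz | ⟨l, a, hz⟩
  · simp [List.reduceOption_append, List.reduceOption_map, hz, word_node,
      List.reduceOption_cons_of_some]
  · simpa [List.reduceOption_append, List.reduceOption_map, hz, word_node,
      List.reduceOption_cons_of_some, List.getLast?_cons] using map_base_ne_const a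

theorem isExtremal_iff {t : Term S} {u : PreorderWord S} {e : ℕ}
    (ht : t.word = u ++ List.replicate e none) (hu : dropNodes (nodeCount u) u = []) {i : ℕ} :
    t.IsExtremal i ↔ leafCount u ≤ i ∧ i < t.arity := by
  have harity : t.arity = leafCount u + e := by
    rw [← leafCount_word, ht, leafCount_append, leafCount_replicate_none]
  rw [harity]
  obtain hi | hi := lt_or_ge i (leafCount u)
  · obtain ⟨x, y, rfl, rfl⟩ := exists_eq_append_none_cons hi
    have hy : nodeCount y ≠ 0 := fun hy => by
      simp [nodeCount_append, nodeCount_none_cons, hy, dropNodes_append, dropNodes_zero] at hu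
    rw [isExtremal_leafCount_iff (z := y ++ List.replicate e none) (by simp [ht])]
    simp [nodeCount_append, hy, hi]
  · obtain ⟨k, rfl⟩ := Nat.exists_eq_add_of_le hi
    obtain hk | hk := lt_or_ge k e
    · obtain ⟨d, rfl⟩ := Nat.exists_eq_add_of_lt hk
      have hext := isExtremal_leafCount_iff (t := t) (u := u ++ List.replicate k none)
        (z := List.replicate d none)
        (by rw [ht, add_assoc, List.replicate_add, List.replicate_succ, List.append_assoc])
      rw [leafCount_append, leafCount_replicate_none] at hext
      simp [hext, nodeCount_replicate_none]
    · exact iff_of_false (fun h => by have := h.1; omega) (by omega)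

end Term

namespace RForest

open PreorderWord

variable {S : ℕ → Type u}

theorem exists_flatMap_word_underTerm (t : Term S) (s : List (Term S)) :
    ∃ c, (underTerm t s).flatMap Term.word
      = takeNodes (nodeCount t.word) t.word
        ++ (s.flatMap Term.word ++ List.replicate c none) := by
  classical
  set u := takeNodes (nodeCount t.word) t.word with hu
  obtain ⟨e, he⟩ := exists_dropNodes_nodeCount t.word
  have ht : t.word = u ++ List.replicate e none := by
    rw [hu, ← he, takeNodes_append_dropNodes]
  have hcount : nodeCount u = nodeCount t.word := by rw [hu, nodeCount_takeNodes, min_self]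
  have hext (i : ℕ) : t.IsExtremal i ↔ leafCount u ≤ i ∧ i < t.arity :=
    Term.isExtremal_iff ht (by rw [hcount, hu, dropNodes_takeNodes])
  have harity : t.arity = leafCount u + e := by
    rw [← Term.leafCount_word, ht, leafCount_append, leafCount_replicate_none]
  refine ⟨e - s.length, ?_⟩
  rw [← Term.flatMap_word_replicate_leaf, ← List.flatMap_append, ← ofFn_getD_append_drop,
    List.flatMap_append, underTerm, List.flatMap_cons, Term.word_comp, ht, substLeaves_append,
    substLeaves_replicate_none, substLeaves_eq_self, count_eq_sub hext le_rfl, harity,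
    Nat.add_sub_cancel_left, List.append_assoc, List.flatMap_def (l := List.ofFn _),
    List.map_ofFn]
  · congr 4
    ext1 i
    have hi : leafCount u + i < t.arity := by omega
    simp only [Function.comp_def, hext, hi, Nat.le_add_right, and_self, if_true,
      count_eq_sub hext hi.le, Nat.add_sub_cancel_left]
  · intro i hi
    simp [hext, hi.not_ge, Term.word]

theorem underList_append_singleton (p : List (Term S)) (t : Term S) (s : List (Term S)) :
    underList (p ++ [t]) s = p ++ underTerm t s := by
  induction p with
  | nil => rfl
  | cons x p ih => cases p <;> simp_all [underList]

theorem nodeCount_word_pos {t : Term S} (ht : t ≠ .leaf) : 0 < nodeCount t.word := by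
  cases t with
  | leaf => exact absurd rfl ht
  | node g ts => simp [Term.word, nodeCount_some_cons]

theorem exists_word_opUnder (f g : RForest S) :
    ∃ c, (f.opUnder g).word
      = takeNodes f.degree f.word ++ (g.word ++ List.replicate c none) := by
  obtain ⟨L, hL⟩ := f
  obtain rfl | ⟨p, t, rfl⟩ := List.eq_nil_or_concat' L
  · exact ⟨0, by simp [opUnder, underList, word, degree, nodeCount_nil, takeNodes_zero]⟩
  · obtain ⟨c, hc⟩ := exists_flatMap_word_underTerm t g.1
    have ht := nodeCount_word_pos (hL t (by simp))
    refine ⟨c, ?_⟩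
    simp only [opUnder, underList_append_singleton, word, degree, List.flatMap_append,
      List.flatMap_singleton, nodeCount_append, takeNodes_append, Nat.add_sub_cancel_left, hc]
    rw [takeNodes_of_lt (w := p.flatMap Term.word) (by omega), List.append_assoc]

end RForest

/-! ### Over and under as adjoints of the cut -/

namespace PreorderWord.Slide

variable {S : ℕ → Type u} [IsEmpty (S 0)]

theorem read_takeNodes_append_le {w w' : PreorderWord S} (h : Slide w w') (m : ℕ)
    (x : PreorderWord S) :
    RForest.read (takeNodes m w ++ x) ≤ RForest.read (takeNodes m w' ++ x) := by
  obtain ⟨u, t, z⟩ := h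
  simp only [takeNodes_append]
  rcases m - nodeCount u with _ | k
  · simp [takeNodes_zero]
  rcases hj : k + 1 - nodeCount t.word with _ | j
  · simpa [takeNodes, takeNodes_append, hj, takeNodes_zero]
      using RForest.read_append_none_cons_le (takeNodes m u) (takeNodes (k + 1) t.word ++ x)
  · have ht : takeNodes (k + 1) t.word = t.word := takeNodes_of_lt (by omega)
    simpa [takeNodes, takeNodes_append, hj, ht]
      using (mk (takeNodes m u) t (takeNodes (j + 1) z ++ x)).read_le

theorem read_dropNodes_le {w w' : PreorderWord S} (h : Slide w w') (m : ℕ) :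
    RForest.read (dropNodes m w) ≤ RForest.read (dropNodes m w') := by
  obtain ⟨u, t, z⟩ := h
  simp only [dropNodes_append]
  rcases hk : m - nodeCount u with _ | k
  · simpa [dropNodes_zero] using (mk (dropNodes m u) t z).read_le
  have hu : dropNodes m u = [] := dropNodes_of_lt (by omega)
  obtain ⟨M, hM⟩ := exists_dropNodes_word t (k + 1)
  simp only [hu, hM, dropNodes, dropNodes_append, List.nil_append, RForest.read_flatMap_word_append]
  rcases k + 1 - nodeCount t.word with _ | j
  · have hz := RForest.read_replicate_none_append 1 z
    simp only [dropNodes_zero]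
    exact (congrArg _ hz.symm).le
  · simp only [dropNodes, le_refl]

end PreorderWord.Slide

namespace RForest

open PreorderWord

variable {S : ℕ → Type u}

/-- The cut of a reduced forest into its first `m` internal nodes in preorder, and the others. Each
of the two parts is reduced, with leaves in place of the missing children. -/
noncomputable def cut (m : ℕ) (f : RForest S) : RForest S × RForest S :=
  (read (takeNodes m f.word), read (dropNodes m f.word))

theorem read_takeNodes_degree (f : RForest S) : read (takeNodes f.degree f.word) = f := by
  obtain ⟨k, hk⟩ := exists_dropNodes_nodeCount f.word
  rw [← read_append_replicate_none _ k, degree, ← hk, takeNodes_append_dropNodes, read_word]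

theorem cut_degree_mul (f g : RForest S) : cut f.degree (f * g) = (f, g) := by
  obtain ⟨k, hk⟩ := exists_dropNodes_nodeCount f.word
  rw [cut, word_mul, takeNodes_append, dropNodes_append, degree, Nat.sub_self, takeNodes_zero,
    dropNodes_zero, List.append_nil, hk, read_replicate_none_append, read_word, ← degree,
    read_takeNodes_degree]

theorem opUnder_eq_read (f g : RForest S) :
    f.opUnder g = read (takeNodes f.degree f.word ++ g.word) := by
  obtain ⟨c, hc⟩ := exists_word_opUnder f g
  rw [← read_word (f.opUnder g), hc, ← List.append_assoc, read_append_replicate_none]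

theorem cut_degree_opUnder (f g : RForest S) : cut f.degree (f.opUnder g) = (f, g) := by
  obtain ⟨c, hc⟩ := exists_word_opUnder f g
  have hcount : nodeCount (takeNodes f.degree f.word) = f.degree := by
    rw [nodeCount_takeNodes, degree, min_self]
  rw [cut, hc, takeNodes_append, dropNodes_append, hcount, Nat.sub_self, takeNodes_zero,
    dropNodes_zero, List.append_nil, takeNodes_takeNodes, dropNodes_takeNodes, List.nil_append,
    read_append_replicate_none, read_word, read_takeNodes_degree]

variable [IsEmpty (S 0)]

theorem read_takeNodes_append_none_cons_le (m : ℕ) (x u w : PreorderWord S) :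
    read (takeNodes m (u ++ none :: w) ++ x) ≤ read (takeNodes m (u ++ w) ++ x) := by
  simp only [takeNodes_append, List.append_assoc]
  rcases m - nodeCount u with _ | k
  · simp only [takeNodes_zero, le_refl]
  · exact read_append_none_cons_le (takeNodes m u) _

theorem read_dropNodes_append_none_cons_le (m : ℕ) (u w : PreorderWord S) :
    read (dropNodes m (u ++ none :: w)) ≤ read (dropNodes m (u ++ w)) := by
  simp only [dropNodes_append]
  rcases m - nodeCount u with _ | k
  · simpa only [dropNodes_zero] using read_append_none_cons_le (dropNodes m u) w
  · simp only [dropNodes, le_refl]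

theorem monotone_read_takeNodes_append (m : ℕ) (x : PreorderWord S) :
    Monotone fun f : RForest S => read (takeNodes m f.word ++ x) :=
  monotone_of_slide (fun h => h.read_takeNodes_append_le m x)
    (read_takeNodes_append_none_cons_le m x)

theorem monotone_read_dropNodes (m : ℕ) :
    Monotone fun f : RForest S => read (dropNodes m f.word) :=
  monotone_of_slide (fun h => h.read_dropNodes_le m) (read_dropNodes_append_none_cons_le m)

theorem monotone_read_append_word_append (x y : PreorderWord S) :
    Monotone fun f : RForest S => read (x ++ (f.word ++ y)) :=
  monotone_of_slide (fun h => (h.append_append x y).read_le)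
    (fun u w => by simpa using read_append_none_cons_le (x ++ u) (w ++ y))

instance : MulLeftMono (RForest S) where
  elim f g h hgh := by
    simpa [read_word_append, read_word] using monotone_read_append_word_append f.word [] hgh

instance : MulRightMono (RForest S) where
  elim g f h hfh := by
    simpa [read_word_append, read_word, Function.swap] using
      monotone_read_append_word_append [] g.word hfh

theorem monotone_cut (m : ℕ) : Monotone (cut (S := S) m) := fun _ _ h =>
  ⟨by simpa [cut] using monotone_read_takeNodes_append m [] h, monotone_read_dropNodes m h⟩

theorem cut_fst_mul_cut_snd_le (m : ℕ) (f : RForest S) : (cut m f).1 * (cut m f).2 ≤ f := by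
  simpa [cut, takeNodes_append_dropNodes, read_word]
    using read_mul_read_le (takeNodes m f.word) (dropNodes m f.word)

theorem read_append_le_of_nodeCount_eq {m : ℕ} {u : PreorderWord S} (hu : nodeCount u = m)
    (hfix : takeNodes m u = u) (x : PreorderWord S) :
    read (u ++ x) ≤ read (takeNodes m (read u).word ++ x) := by
  obtain ⟨r, hr⟩ := exists_flatMap_word_parse u
  calc read (u ++ x) = read (takeNodes m ((parse u).flatMap Term.word) ++ x) := by
        rw [hr, takeNodes_append, hu, Nat.sub_self, takeNodes_zero, List.append_nil, hfix]
    _ ≤ read (takeNodes m (read u).word ++ x) :=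
        le_map_word_reduce (Φ := fun w => read (takeNodes m w ++ x))
          (read_takeNodes_append_none_cons_le m x) [] (parse u)

theorem opOver_le_iff {f g h : RForest S} : f.opOver g ≤ h ↔ (f, g) ≤ cut f.degree h := by
  change f * g ≤ h ↔ _
  constructor
  · intro hle
    simpa only [cut_degree_mul] using monotone_cut f.degree hle
  · intro hle
    exact (mul_le_mul' hle.1 hle.2).trans (cut_fst_mul_cut_snd_le f.degree h)

theorem le_opUnder_iff {f g h : RForest S} : h ≤ f.opUnder g ↔ cut f.degree h ≤ (f, g) := by
  constructor
  · intro hle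
    simpa only [cut_degree_opUnder] using monotone_cut f.degree hle
  · rintro ⟨hf, hg⟩
    simp only [cut] at hf hg
    set u := takeNodes f.degree h.word with hu
    have hcount : nodeCount u = f.degree := by rw [← degree_read, degree_eq_of_le hf]
    calc h = read (u ++ dropNodes f.degree h.word) := by
          rw [hu, takeNodes_append_dropNodes, read_word]
      _ ≤ read (u ++ (read (dropNodes f.degree h.word)).word) := read_append_le_read_append_word _ _
      _ ≤ read (u ++ g.word) := by simpa using monotone_read_append_word_append u [] hg
      _ ≤ read (takeNodes f.degree (read u).word ++ g.word) :=
          read_append_le_of_nodeCount_eq hcount (takeNodes_takeNodes _ _) _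
      _ ≤ read (takeNodes f.degree f.word ++ g.word) := monotone_read_takeNodes_append _ _ hf
      _ = f.opUnder g := (opUnder_eq_read f g).symm

theorem mem_Icc_opOver_opUnder {f g h : RForest S} :
    h ∈ Finset.Icc (f.opOver g) (f.opUnder g) ↔ cut f.degree h = (f, g) := by
  rw [Finset.mem_Icc, opOver_le_iff, le_opUnder_iff, and_comm, le_antisymm_iff]

end RForest

/-! ### The three bases -/

theorem sum_Ici_sum_Ici_mu_smul {α R M : Type*} [PartialOrder α] [LocallyFiniteOrder α]
    [LocallyFiniteOrderTop α] [DecidableEq α] [Ring R] [AddCommMonoid M] [Module R M]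
    (φ : α → M) (x : α) :
    ∑ y ∈ Finset.Ici x, ∑ z ∈ Finset.Ici y, IncidenceAlgebra.mu R y z • φ z = φ x := by
  calc _ = ∑ z ∈ Finset.Ici x, (∑ y ∈ Finset.Icc x z, IncidenceAlgebra.mu R y z) • φ z := by
        simp_rw [Finset.sum_smul]
        refine Finset.sum_comm' fun y z => ?_
        simp only [Finset.mem_Ici, Finset.mem_Icc]
        exact ⟨fun h => ⟨h, h.1.trans h.2⟩, fun h => h.1⟩
    _ = φ x := by
        simp [IncidenceAlgebra.sum_Icc_mu_left]

theorem eq_of_sum_Ici_eq {α M : Type*} [PartialOrder α] [LocallyFiniteOrderTop α]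
    [AddCancelCommMonoid M] {φ ψ : α → M}
    (h : ∀ x, ∑ y ∈ Finset.Ici x, φ y = ∑ y ∈ Finset.Ici x, ψ y) (x : α) : φ x = ψ x := by
  induction hn : (Finset.Ici x).card using Nat.strong_induction_on generalizing x with
  | _ n ih =>
    have hIoi : ∑ y ∈ Finset.Ioi x, φ y = ∑ y ∈ Finset.Ioi x, ψ y :=
      Finset.sum_congr rfl fun y hy => ih _ (hn ▸ Finset.card_lt_card
        (Finset.Ici_ssubset_Ici.2 (Finset.mem_Ioi.1 hy))) y rfl
    have hx := h x
    rw [Finset.Ici_eq_cons_Ioi, Finset.sum_cons, Finset.sum_cons, hIoi] at hx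
    exact add_right_cancel hx

namespace RForest

variable {S : ℕ → Type u} [IsEmpty (S 0)] {M : Type*} [AddCommMonoid M]

theorem sum_Ici_opOver [DecidableLE (RForest S)] (φ : RForest S → M) (f g : RForest S) :
    ∑ h ∈ Finset.Ici (f.opOver g), φ h
      = ∑ p ∈ Finset.Ici (f, g), ∑ h ∈ Finset.Icc (p.1.opOver p.2) (p.1.opUnder p.2), φ h := by
  classical
  rw [← Finset.sum_fiberwise_of_maps_to (g := cut f.degree) (t := Finset.Ici (f, g))
    fun h hh => by simpa [← opOver_le_iff] using hh]
  refine Finset.sum_congr rfl fun p hp => Finset.sum_congr (Finset.ext fun h => ?_) fun _ _ => rfl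
  have hle : (f, g) ≤ p := Finset.mem_Ici.1 hp
  rw [mem_Icc_opOver_opUnder, ← degree_eq_of_le hle.1, Finset.mem_filter, Finset.mem_Ici,
    opOver_le_iff]
  exact and_iff_right_of_imp fun h => hle.trans_eq h.symm

theorem sum_Iic_opUnder [DecidableLE (RForest S)] (φ : RForest S → M) (f g : RForest S) :
    ∑ h ∈ Finset.Iic (f.opUnder g), φ h
      = ∑ p ∈ Finset.Iic (f, g), ∑ h ∈ Finset.Icc (p.1.opOver p.2) (p.1.opUnder p.2), φ h := by
  classical
  rw [← Finset.sum_fiberwise_of_maps_to (g := cut f.degree) (t := Finset.Iic (f, g))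
    fun h hh => by simpa [← le_opUnder_iff] using hh]
  refine Finset.sum_congr rfl fun p hp => Finset.sum_congr (Finset.ext fun h => ?_) fun _ _ => rfl
  have hle : p ≤ (f, g) := Finset.mem_Iic.1 hp
  rw [mem_Icc_opOver_opUnder, degree_eq_of_le hle.1, Finset.mem_filter, Finset.mem_Iic,
    le_opUnder_iff]
  exact and_iff_right_of_imp fun h => h.trans_le hle

end RForest

namespace NatAlgebra

variable (K : Type v) [Field K] {S : ℕ → Type u}

theorem E_mul_E (f g : RForest S) : E K f * E K g = E K (f.opOver g) := by
  rw [E, E, MonoidAlgebra.single_mul_single, one_mul]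
  rfl

variable [IsEmpty (S 0)]

theorem sum_Ici_F (f : RForest S) : ∑ g ∈ Finset.Ici f, F K g = E K f := by
  classical exact sum_Ici_sum_Ici_mu_smul (E K) f

theorem F_mul_F (f g : RForest S) :
    F K f * F K g = ∑ h ∈ Finset.Icc (f.opOver g) (f.opUnder g), F K h := by
  classical
  refine eq_of_sum_Ici_eq (φ := fun p : RForest S × RForest S => F K p.1 * F K p.2)
    (ψ := fun p => ∑ h ∈ Finset.Icc (p.1.opOver p.2) (p.1.opUnder p.2), F K h)
    (fun ⟨f, g⟩ => ?_) (f, g)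
  calc ∑ p ∈ Finset.Ici (f, g), F K p.1 * F K p.2
      = (∑ a ∈ Finset.Ici f, F K a) * ∑ b ∈ Finset.Ici g, F K b := by
        rw [Finset.sum_mul_sum, ← Finset.sum_product', Finset.Ici_product_Ici]
    _ = ∑ h ∈ Finset.Ici (f.opOver g), F K h := by
        rw [sum_Ici_F, sum_Ici_F, sum_Ici_F, E_mul_E]
    _ = _ := RForest.sum_Ici_opOver (F K) f g

theorem H_mul_H (f g : RForest S) : H K f * H K g = H K (f.opUnder g) := by
  classical
  calc H K f * H K g
      = ∑ p ∈ Finset.Iic (f, g), F K p.1 * F K p.2 := by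
        rw [H, H, Finset.sum_mul_sum, ← Finset.sum_product', Finset.Iic_product_Iic]
    _ = H K (f.opUnder g) := by
        simp_rw [F_mul_F]
        exact (RForest.sum_Iic_opUnder (F K) f g).symm

end NatAlgebra

theorem mainTheorem3_general (K : Type v) [Field K] (S : ℕ → Type u) [IsEmpty (S 0)]
    (f' f'' : RForest S) :
    NatAlgebra.E K f' * NatAlgebra.E K f'' = NatAlgebra.E K (f'.opOver f'') ∧
    NatAlgebra.F K f' * NatAlgebra.F K f'' =
      ∑ f ∈ Finset.Icc (f'.opOver f'') (f'.opUnder f''), NatAlgebra.F K f ∧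
    NatAlgebra.H K f' * NatAlgebra.H K f'' = NatAlgebra.H K (f'.opUnder f'') :=
  ⟨NatAlgebra.E_mul_E K f' f'', NatAlgebra.F_mul_F K f' f'', NatAlgebra.H_mul_H K f' f''⟩

theorem mainTheorem3 (K : Type v) [Field K] [CharZero K] (S : ℕ → Type u) [IsEmpty (S 0)]
    (f' f'' : RForest S) :
    NatAlgebra.E K f' * NatAlgebra.E K f'' = NatAlgebra.E K (f'.opOver f'') ∧
    NatAlgebra.F K f' * NatAlgebra.F K f'' =
      ∑ f ∈ Finset.Icc (f'.opOver f'') (f'.opUnder f''), NatAlgebra.F K f ∧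
    NatAlgebra.H K f' * NatAlgebra.H K f'' = NatAlgebra.H K (f'.opUnder f'') :=
  mainTheorem3_general K S f' f''
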